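/- Let $A$ be a finite alphabet with $|A|\ge 2$, let $k\ge 0$ and $M\ge 2$ be integers, and fix an initial state $s_0\in A^k$. Let $\mathcal P_k$ be the class of $k$-th order Markov processes $P$ over $A$ with all conditional probabilities $p(a|s)$, $a\in A$, $s\in A^k$, positive, so that $P(x^n)=\prod_{t=1}^n p(x_t|x_{t-k}^{t-1})$ with $x_{-k+1}^0=s_0$. The type class of $x^n\in A^n$ is $T(x^n)=\{y^n\in A^n : P(y^n)=P(x^n)\ \ \forall P\in\mathcal P_k\}$, and $\mathcal T_n$ denotes the set of type classes of strings of length $n$. The greedy truncated variable-to-fixed-length random number generator (TVFR) with output range $\{0,\dots,M-1\}$ is constructed as follows. Start with $\mathcal D=\emptyset$ and $\mathcal F=A$. For $n=1,2,\dots$: for each $T\in\mathcal T_n$, move an arbitrary subset of $\lfloor |\mathcal F\cap T|/M\rfloor\, M$ strings from $\mathcal F\cap T$ to $\mathcal D$, and let the output on each string of length $n$ thus added to $\mathcal D$ be its index, modulo $M$, in some ordering of $\mathcal D\cap T$; then replace each string $x^n$ remaining in $\mathcal F$ by all its extensions $x^na$, $a\in A$. Let $\mathcal D^*_N$ be the set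 $\mathcal D$ after the $N$-th pass through the type classes, let $\mathcal D^*=\bigcup_{N\ge1}\mathcal D^*_N$, and let $\mathcal F^*_N$ be the failure set, i.e., the set of strings in $A^N$ that have no prefix in $\mathcal D^*_N$. Let $$L_P(\mathcal D^*_N)=\sum_{x\in\mathcal D^*_N\cup\mathcal F^*_N}P(x)\,|x|$$ be the expected input length at truncation level $N$. Then, for every $P\in\mathcal P_k$: 1. the failure probability decays exponentially fast with $N$: there are constants $C>0$ and $0<\rho<1$, which do not depend on the arbitrary choices made in the construction, such that $P(\mathcal F^*_N)\le C\rho^N$ for all $N$; 2. consequently, $\sum_{x\in\mathcal D^*}P(x)=1$, the expected dictionary length $\lim_{N\to\infty}\sum_{x\in\mathcal D^*_N}P(x)\,|x|$ of $\mathcal D^*$ exists and is finite, and $L_P(\mathcal D^*_N)$ converges to it as $N\to\infty$. -/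

import Mathlib

open Filter Topology

/-- A `k`-th order finite memory (Markov) process over the finite alphabet `A`: one conditional
probability mass function `p(· | s)` per state `s ∈ A^k`, all conditional probabilities being
nonzero. -/
structure MarkovProcess (A : Type*) [Fintype A] (k : ℕ) where
  p : (Fin k → A) → A → ℝ
  pos : ∀ s a, 0 < p s a
  sum_one : ∀ s, ∑ a, p s a = 1

/-- The state reached from state `s` upon emission of `a`: the last `k` symbols of `s a`. -/
def nextState {A : Type*} {k : ℕ} (s : Fin k → A) (a : A) : Fin k → A :=
  Fin.tail (Fin.snoc s a : Fin (k + 1) → A)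

/-- The probability `P(x^n | s) = ∏ₜ p(xₜ | x_{t-k}^{t-1})`, where `x_{-k+1}^0 = s` is the
initial state. -/
def MarkovProcess.prob {A : Type*} [Fintype A] {k : ℕ} (P : MarkovProcess A k) :
    (Fin k → A) → List A → ℝ
  | _, [] => 1
  | s, a :: x => P.p s a * P.prob (nextState s a) x

/-- The probability of a finite set of strings. -/
def MarkovProcess.probSet {A : Type*} [Fintype A] {k : ℕ} (P : MarkovProcess A k)
    (s₀ : Fin k → A) (S : Finset (List A)) : ℝ :=
  ∑ x ∈ S, P.prob s₀ x

/-- The sum `∑_{x ∈ S} P(x) |x|` of the string lengths over a finite set of strings, weighted by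
their probabilities. -/
def MarkovProcess.lengthSum {A : Type*} [Fintype A] {k : ℕ} (P : MarkovProcess A k)
    (s₀ : Fin k → A) (S : Finset (List A)) : ℝ :=
  ∑ x ∈ S, P.prob s₀ x * (x.length : ℝ)

/-- `A^n`, the set of strings of length `n`. -/
def words (A : Type*) [Fintype A] (n : ℕ) : Finset (List A) :=
  (Finset.univ : Finset (Fin n → A)).map ⟨List.ofFn, List.ofFn_injective⟩

open Classical in
/-- The type class of `x`: the strings of the same length that have the same probability as `x`
under every `k`-th order process with initial state `s₀`. -/
noncomputable def typeClass {A : Type*} [Fintype A] {k : ℕ} (s₀ : Fin k → A) (x : List A) :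
    Finset (List A) :=
  (words A x.length).filter fun y => ∀ P : MarkovProcess A k, P.prob s₀ x = P.prob s₀ y

/-- The set of all type classes of strings of length `n`. -/
noncomputable def typeClasses {A : Type*} [Fintype A] [DecidableEq A] {k : ℕ}
    (s₀ : Fin k → A) (n : ℕ) : Finset (Finset (List A)) :=
  (words A n).image (typeClass s₀)

open Classical in
/-- The restriction `D_N` of `D` to level `N`: the strings in `D` of length at most `N`. -/
noncomputable def truncDict {A : Type*} [Fintype A] (D : Set (List A)) (N : ℕ) :
    Finset (List A) :=
  ((Finset.range (N + 1)).biUnion (words A)).filter (· ∈ D)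

open Classical in
/-- The failure set of `D` at truncation level `N`: the strings of length `N` that have no prefix
in `D_N`. -/
noncomputable def failureSet {A : Type*} [Fintype A] (D : Set (List A)) (N : ℕ) :
    Finset (List A) :=
  (words A N).filter fun x => ∀ y ∈ truncDict D N, ¬ y <+: x

/-- The expected input length at truncation level `N`, i.e., the expectation of the string length
over `D_N ∪ F_N`, where `F_N` is the failure set. -/
noncomputable def expectedInputLength {A : Type*} [Fintype A] [DecidableEq A] {k : ℕ}
    (P : MarkovProcess A k) (s₀ : Fin k → A) (D : Set (List A)) (N : ℕ) : ℝ :=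
  P.lengthSum s₀ (truncDict D N ∪ failureSet D N)

/-- `L` is the expected dictionary length of `D`, i.e., the limit as `N → ∞` of the sums
`∑_{x ∈ D_N} P(x) |x|`. -/
def IsExpectedDictionaryLength {A : Type*} [Fintype A] {k : ℕ}
    (P : MarkovProcess A k) (s₀ : Fin k → A) (D : Set (List A)) (L : ℝ) : Prop :=
  Tendsto (fun N => P.lengthSum s₀ (truncDict D N)) atTop (𝓝 L)

/-- All one-symbol extensions of the strings in `F`. -/
def extendWords {A : Type*} [Fintype A] [DecidableEq A] (F : Finset (List A)) :
    Finset (List A) :=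
  F.biUnion fun x => Finset.univ.image fun a => x ++ [a]

/-- One pass of the greedy procedure through the type classes of length `n`, from the working sets
`(D, F)` to `(D', F')`: from each `F(T)`, an arbitrary subset of `⌊|F(T)| / M⌋ * M` strings is
moved to the dictionary. -/
def GreedySelection {A : Type*} [Fintype A] [DecidableEq A] {k : ℕ} (s₀ : Fin k → A)
    (M n : ℕ) (D F D' F' : Finset (List A)) : Prop :=
  ∃ S ⊆ F, (∀ T ∈ typeClasses s₀ n, (S ∩ T).card = (F ∩ T).card / M * M) ∧
    D' = D ∪ S ∧ F' = F \ S

/-- A greedy variable-to-fixed-length random number generator with output range `{0, …, M-1}`,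
given by an execution of the greedy procedure: `D n` and `F n` are its working sets (dictionary and
failure set) upon completion of the pass for length `n`, so that `D N` is the output of the
procedure at truncation level `N`. Starting with `F = {λ}` at `n = 0` yields `F = A^1` at the
beginning of the pass for `n = 1`. The output function `out` numbers the selected strings of each
type class modulo `M`. -/
structure GreedyVFR {A : Type*} [Fintype A] [DecidableEq A] {k : ℕ} (s₀ : Fin k → A) (M : ℕ) where
  D : ℕ → Finset (List A)
  F : ℕ → Finset (List A)
  init_D : D 0 = ∅
  init_F : F 0 = {[]}
  step : ∀ n, GreedySelection s₀ M (n + 1) (D n) (extendWords (F n)) (D (n + 1)) (F (n + 1))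
  out : List A → Fin M
  out_index : ∀ n, 1 ≤ n → ∀ T ∈ typeClasses s₀ n,
    ∃ index : {y // y ∈ D n ∩ T} ≃ Fin (D n ∩ T).card,
      ∀ y, (out y.1 : ℕ) = (index y : ℕ) % M

/-- The dictionary `D* = ⋃_N D*_N` of the greedy generator. -/
def GreedyVFR.dict {A : Type*} [Fintype A] [DecidableEq A] {k : ℕ} {s₀ : Fin k → A} {M : ℕ}
    (V : GreedyVFR s₀ M) : Set (List A) :=
  {x | ∃ N, 1 ≤ N ∧ x ∈ V.D N}

/-! After a pass, each type class retains only the remainder modulo `M` of its strings, hence fewer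
than `M`. The number of occurrences of each transition determines a string's probability under every
process, so there are at most `(N + 1) ^ d` type classes of length `N`, with `d = |A ^ k × A|`.
Every string of length `N` has probability at most `q ^ N`, where `q < 1` is the largest conditional
probability. Thus `P(F_N) ≤ M (N + 1) ^ d q ^ N`, which decays geometrically (`probSet_F_le`).

The rest is conservation: `P(D_N) + P(F_N) = 1`, and the lengths satisfy the tail-sum formula
`∑_{D_N} P(x)|x| + N P(F_N) = ∑_{i<N} P(F_i)` (`lengthSum_D_add_lengthSum_F`). The series converges
and `N P(F_N) → 0`. -/

theorem mem_words {A : Type*} [Fintype A] {n : ℕ} {x : List A} :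
    x ∈ words A n ↔ x.length = n := by
  constructor
  · intro h
    obtain ⟨f, -, rfl⟩ := Finset.mem_map.1 h
    exact List.length_ofFn
  · rintro rfl
    exact Finset.mem_map.2 ⟨x.get, Finset.mem_univ _, List.ofFn_get x⟩

theorem mem_typeClass {A : Type*} [Fintype A] {k : ℕ} {s₀ : Fin k → A} {x y : List A} :
    y ∈ typeClass s₀ x ↔
      y.length = x.length ∧ ∀ P : MarkovProcess A k, P.prob s₀ x = P.prob s₀ y := by
  simp [typeClass, mem_words]

theorem mem_truncDict {A : Type*} [Fintype A] {D : Set (List A)} {N : ℕ} {x : List A} :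
    x ∈ truncDict D N ↔ x.length ≤ N ∧ x ∈ D := by
  simp [truncDict, mem_words]

theorem mem_extendWords {A : Type*} [Fintype A] [DecidableEq A] {F : Finset (List A)}
    {x : List A} : x ∈ extendWords F ↔ ∃ y ∈ F, ∃ a, y ++ [a] = x := by
  simp [extendWords]

/-- The list of (state, emitted symbol) pairs visited along a string. -/
def transitions {A : Type*} {k : ℕ} : (Fin k → A) → List A → List ((Fin k → A) × A)
  | _, [] => []
  | s, a :: x => (s, a) :: transitions (nextState s a) x

theorem length_transitions {A : Type*} {k : ℕ} (s : Fin k → A) (x : List A) :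
    (transitions s x).length = x.length := by
  induction x generalizing s with
  | nil => rfl
  | cons a x ih => simp [transitions, ih]

/-! ### Bounds and conservation of probability. -/

namespace MarkovProcess

variable {A : Type*} [Fintype A] {k : ℕ} (P : MarkovProcess A k)

theorem prob_eq_prod_transitions (s : Fin k → A) (x : List A) :
    P.prob s x = ((transitions s x).map fun t => P.p t.1 t.2).prod := by
  induction x generalizing s with
  | nil => rfl
  | cons a x ih => simp [transitions, prob, ih]

theorem prob_nonneg (s : Fin k → A) (x : List A) : 0 ≤ P.prob s x := by
  induction x generalizing s with
  | nil => exact zero_le_one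
  | cons a x ih => exact mul_nonneg (P.pos s a).le (ih _)

theorem prob_le_pow {q : ℝ} (hq : ∀ s a, P.p s a ≤ q) (s : Fin k → A) (x : List A) :
    P.prob s x ≤ q ^ x.length := by
  induction x generalizing s with
  | nil => exact le_rfl
  | cons a x ih =>
    rw [List.length_cons, pow_succ']
    exact mul_le_mul (hq s a) (ih _) (P.prob_nonneg _ _) ((P.pos s a).le.trans (hq s a))

theorem sum_prob_append_singleton (s : Fin k → A) (x : List A) :
    ∑ a, P.prob s (x ++ [a]) = P.prob s x := by
  induction x generalizing s with
  | nil => simp [prob, P.sum_one]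
  | cons b x ih => simp only [List.cons_append, prob, ← Finset.mul_sum, ih]

theorem p_lt_one [Nontrivial A] (s : Fin k → A) (a : A) : P.p s a < 1 := by
  obtain ⟨b, hb⟩ := exists_ne a
  rw [← P.sum_one s]
  exact Finset.single_lt_sum hb (Finset.mem_univ _) (Finset.mem_univ _) (P.pos s b)
    fun c _ _ => (P.pos s c).le

theorem exists_p_le_lt_one [Nontrivial A] : ∃ q : ℝ, 0 < q ∧ q < 1 ∧ ∀ s a, P.p s a ≤ q := by
  obtain ⟨t, ht⟩ := Finite.exists_max fun t : (Fin k → A) × A => P.p t.1 t.2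
  exact ⟨P.p t.1 t.2, P.pos _ _, P.p_lt_one _ _, fun s a => ht (s, a)⟩

theorem probSet_nonneg (s₀ : Fin k → A) (S : Finset (List A)) : 0 ≤ P.probSet s₀ S :=
  Finset.sum_nonneg fun x _ => P.prob_nonneg s₀ x

theorem probSet_mono (s₀ : Fin k → A) {S T : Finset (List A)} (h : S ⊆ T) :
    P.probSet s₀ S ≤ P.probSet s₀ T :=
  Finset.sum_le_sum_of_subset_of_nonneg h fun x _ _ => P.prob_nonneg s₀ x

theorem lengthSum_eq_mul_probSet (s₀ : Fin k → A) {S : Finset (List A)} {n : ℕ}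
    (h : ∀ x ∈ S, x.length = n) : P.lengthSum s₀ S = n * P.probSet s₀ S := by
  rw [lengthSum, probSet, Finset.mul_sum]
  exact Finset.sum_congr rfl fun x hx => by rw [h x hx, mul_comm]

variable [DecidableEq A]

theorem probSet_extendWords (s₀ : Fin k → A) (F : Finset (List A)) :
    P.probSet s₀ (extendWords F) = P.probSet s₀ F := by
  rw [probSet, probSet, extendWords, Finset.sum_biUnion]
  · refine Finset.sum_congr rfl fun x _ => ?_
    rw [Finset.sum_image fun a _ b _ h => by simpa using h, P.sum_prob_append_singleton]
  · intro x _ y _ hxy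
    refine Finset.disjoint_left.2 fun z hz hz' => hxy ?_
    simp only [Finset.mem_image, Finset.mem_univ, true_and] at hz hz'
    obtain ⟨a, rfl⟩ := hz
    obtain ⟨b, hb⟩ := hz'
    exact (List.append_inj' hb rfl).1.symm

end MarkovProcess

/-! ### Polynomially many type classes. -/

/-- The number of occurrences of each transition along a string of length at most `N`. -/
def transitionCounts {A : Type*} [DecidableEq A] {k : ℕ} (s₀ : Fin k → A) (N : ℕ) (x : List A) :
    (Fin k → A) × A → Fin (N + 1) :=
  fun t => Fin.ofNat (N + 1) ((transitions s₀ x).count t)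

/-- Equal counts make the transition lists permutations of each other, and a probability is a
product over that list. Counts never exceed `N`, so reduction modulo `N + 1` loses nothing. -/
theorem mem_typeClass_of_transitionCounts_eq {A : Type*} [Fintype A] [DecidableEq A] {k : ℕ}
    {s₀ : Fin k → A} {N : ℕ} {x y : List A} (hx : x.length = N) (hy : y.length = N)
    (h : transitionCounts s₀ N x = transitionCounts s₀ N y) : y ∈ typeClass s₀ x := by
  refine mem_typeClass.2 ⟨hy.trans hx.symm, fun P => ?_⟩
  have hperm : (transitions s₀ x).Perm (transitions s₀ y) := by
    refine List.perm_iff_count.2 fun t => ?_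
    have ht := congrArg Fin.val (congrFun h t)
    have h₁ : (transitions s₀ x).count t < N + 1 :=
      Nat.lt_succ_of_le (List.count_le_length.trans (by rw [length_transitions, hx]))
    have h₂ : (transitions s₀ y).count t < N + 1 :=
      Nat.lt_succ_of_le (List.count_le_length.trans (by rw [length_transitions, hy]))
    simpa [transitionCounts, Nat.mod_eq_of_lt h₁, Nat.mod_eq_of_lt h₂] using ht
  rw [P.prob_eq_prod_transitions, P.prob_eq_prod_transitions]
  exact (hperm.map _).prod_eq

/-- Each fibre of the count map on `F` lies in a single type class. -/
theorem card_le_of_card_inter_typeClass_le {A : Type*} [Fintype A] [DecidableEq A] {k : ℕ}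
    {s₀ : Fin k → A} {M N : ℕ} {F : Finset (List A)} (hF : ∀ x ∈ F, x.length = N)
    (hT : ∀ T ∈ typeClasses s₀ N, (F ∩ T).card ≤ M) :
    F.card ≤ M * (N + 1) ^ Fintype.card ((Fin k → A) × A) := by
  have hcard : F.card ≤ M * (F.image (transitionCounts s₀ N)).card := by
    refine Finset.card_le_mul_card_image F M fun c hc => ?_
    obtain ⟨x, hx, rfl⟩ := Finset.mem_image.1 hc
    refine le_trans (Finset.card_le_card fun y hy => ?_)
      (hT (typeClass s₀ x) (Finset.mem_image_of_mem _ (mem_words.2 (hF x hx))))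
    obtain ⟨hy, hyx⟩ := Finset.mem_filter.1 hy
    exact Finset.mem_inter.2
      ⟨hy, mem_typeClass_of_transitionCounts_eq (hF x hx) (hF y hy) hyx.symm⟩
  refine hcard.trans (Nat.mul_le_mul_left M ((Finset.card_le_univ _).trans ?_))
  rw [Fintype.card_fun, Fintype.card_fin]

/-- For any `ρ` strictly between `q` and 1, the factor `(q / ρ) ^ n` absorbs the polynomial. -/
theorem exists_polynomial_mul_pow_le_geometric (d : ℕ) {q : ℝ} (hq : 0 < q) (hq1 : q < 1) :
    ∃ C ρ : ℝ, 0 < C ∧ 0 < ρ ∧ ρ < 1 ∧ ∀ n : ℕ, ((n : ℝ) + 1) ^ d * q ^ n ≤ C * ρ ^ n := by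
  obtain ⟨ρ, hqρ, hρ1⟩ := exists_between hq1
  have hρ : 0 < ρ := hq.trans hqρ
  have hr : 0 < q / ρ := div_pos hq hρ
  have hlim := tendsto_pow_const_mul_const_pow_of_abs_lt_one d
    (r := q / ρ) (by rw [abs_of_pos hr]; exact (div_lt_one hρ).2 hqρ)
  obtain ⟨B, hB⟩ := hlim.bddAbove_range
  have hB0 : ∀ n : ℕ, (n : ℝ) ^ d * (q / ρ) ^ n ≤ B := fun n => hB ⟨n, rfl⟩
  have hBpos : 0 < B := lt_of_lt_of_le (by simpa using hr) (hB0 1)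
  refine ⟨B / (q / ρ), ρ, div_pos hBpos hr, hρ, hρ1, fun n => ?_⟩
  have h : ((n : ℝ) + 1) ^ d * (q / ρ) ^ n ≤ B / (q / ρ) := by
    -- The bound `B` is used at `n + 1`, which costs one factor `q / ρ`.
    rw [le_div_iff₀ hr, mul_assoc, ← pow_succ]
    exact_mod_cast hB0 (n + 1)
  calc ((n : ℝ) + 1) ^ d * q ^ n = ((n : ℝ) + 1) ^ d * (q / ρ) ^ n * ρ ^ n := by
        rw [mul_assoc, ← mul_pow, div_mul_cancel₀ _ hρ.ne']
    _ ≤ B / (q / ρ) * ρ ^ n := mul_le_mul_of_nonneg_right h (pow_nonneg hρ.le n)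

/-! ### The working sets of the greedy procedure. -/

namespace GreedyVFR

variable {A : Type*} [Fintype A] [DecidableEq A] {k : ℕ} {s₀ : Fin k → A} {M : ℕ}
  (V : GreedyVFR s₀ M)

theorem length_of_mem_F {n : ℕ} {x : List A} (hx : x ∈ V.F n) : x.length = n := by
  induction n generalizing x with
  | zero =>
    rw [V.init_F, Finset.mem_singleton] at hx
    simp [hx]
  | succ n ih =>
    obtain ⟨S, -, -, -, hF⟩ := V.step n
    rw [hF] at hx
    obtain ⟨y, hy, a, rfl⟩ := mem_extendWords.1 (Finset.mem_sdiff.1 hx).1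
    simp [ih hy]

theorem length_of_mem_extendWords_F {n : ℕ} {x : List A} (hx : x ∈ extendWords (V.F n)) :
    x.length = n + 1 := by
  obtain ⟨y, hy, a, rfl⟩ := mem_extendWords.1 hx
  simp [V.length_of_mem_F hy]

theorem length_le_of_mem_D {n : ℕ} {x : List A} (hx : x ∈ V.D n) : x.length ≤ n := by
  induction n with
  | zero => simp [V.init_D] at hx
  | succ n ih =>
    obtain ⟨S, hS, -, hD, -⟩ := V.step n
    rw [hD] at hx
    rcases Finset.mem_union.1 hx with hx | hx
    · exact (ih hx).trans n.le_succ
    · exact (V.length_of_mem_extendWords_F (hS hx)).le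

theorem D_mono : Monotone V.D := by
  refine monotone_nat_of_le_succ fun n => ?_
  obtain ⟨S, -, -, hD, -⟩ := V.step n
  rw [hD]
  exact Finset.subset_union_left

/-- The pass for length `n` adds only strings of length exactly `n`, so later passes never alter
`D_N` at lengths up to `N`. -/
theorem mem_D_of_length_le {N n : ℕ} {x : List A} (hx : x ∈ V.D n) (hN : x.length ≤ N) :
    x ∈ V.D N := by
  induction n with
  | zero => simp [V.init_D] at hx
  | succ n ih =>
    by_cases h : n + 1 ≤ N
    · exact V.D_mono h hx
    obtain ⟨S, hS, -, hD, -⟩ := V.step n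
    rw [hD] at hx
    rcases Finset.mem_union.1 hx with hx | hx
    · exact ih hx
    · exact absurd ((V.length_of_mem_extendWords_F (hS hx)).ge.trans hN) h

theorem mem_dict_of_mem_D {n : ℕ} {x : List A} (hx : x ∈ V.D n) : x ∈ V.dict :=
  ⟨n + 1, Nat.le_add_left 1 n, V.D_mono n.le_succ hx⟩

theorem truncDict_dict (N : ℕ) : truncDict V.dict N = V.D N := by
  ext x
  rw [mem_truncDict]
  constructor
  · rintro ⟨hN, n, -, hx⟩
    exact V.mem_D_of_length_le hx hN
  · exact fun hx => ⟨V.length_le_of_mem_D hx, V.mem_dict_of_mem_D hx⟩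

theorem mem_failureSet_dict {N : ℕ} {x : List A} :
    x ∈ failureSet V.dict N ↔ x.length = N ∧ ∀ y ∈ V.D N, ¬ y <+: x := by
  simp [failureSet, truncDict_dict, mem_words]

/-- This inclusion transfers the bounds on the working set to the failure set. -/
theorem failureSet_dict_subset (N : ℕ) : failureSet V.dict N ⊆ V.F N := by
  induction N with
  | zero =>
    intro x hx
    have hx := (V.mem_failureSet_dict.1 hx).1
    rw [V.init_F, Finset.mem_singleton]
    exact List.length_eq_zero_iff.1 hx
  | succ N ih =>
    intro x hx
    obtain ⟨hlen, hpre⟩ := V.mem_failureSet_dict.1 hx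
    obtain ⟨y, a, rfl⟩ : ∃ y a, x = y ++ [a] := by
      rcases List.eq_nil_or_concat' x with rfl | h
      · simp at hlen
      · exact h
    have hy : y ∈ V.F N := ih (V.mem_failureSet_dict.2 ⟨by simpa using hlen,
      fun z hz h => hpre z (V.D_mono N.le_succ hz) (h.trans (List.prefix_append _ _))⟩)
    obtain ⟨S, -, -, hD, hF⟩ := V.step N
    rw [hF, Finset.mem_sdiff]
    refine ⟨mem_extendWords.2 ⟨y, hy, a, rfl⟩, fun h => hpre _ ?_ List.prefix_rfl⟩
    rw [hD]
    exact Finset.mem_union_right _ h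

theorem disjoint_D_failureSet_dict (N : ℕ) : Disjoint (V.D N) (failureSet V.dict N) :=
  Finset.disjoint_left.2 fun x hx hx' => (V.mem_failureSet_dict.1 hx').2 x hx List.prefix_rfl

theorem card_F_inter_le (hM : 0 < M) (n : ℕ) {T : Finset (List A)} (hT : T ∈ typeClasses s₀ n) :
    (V.F n ∩ T).card ≤ M := by
  cases n with
  | zero =>
    refine (Finset.card_le_card Finset.inter_subset_left).trans ?_
    rw [V.init_F, Finset.card_singleton]
    exact hM
  | succ n =>
    obtain ⟨S, hS, hcard, -, hF⟩ := V.step n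
    have h : V.F (n + 1) ∩ T = (extendWords (V.F n) ∩ T) \ (S ∩ T) := by
      rw [hF]
      ext x
      simp only [Finset.mem_inter, Finset.mem_sdiff]
      tauto
    rw [h, Finset.card_sdiff_of_subset (Finset.inter_subset_inter_right hS), hcard T hT]
    have h₁ := Nat.div_add_mod' (extendWords (V.F n) ∩ T).card M
    have h₂ := Nat.mod_lt (extendWords (V.F n) ∩ T).card hM
    omega

theorem probSet_F_le (hM : 0 < M) (P : MarkovProcess A k) {q : ℝ} (hq : ∀ s a, P.p s a ≤ q)
    (N : ℕ) : P.probSet s₀ (V.F N) ≤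
      M * (((N : ℝ) + 1) ^ Fintype.card ((Fin k → A) × A) * q ^ N) := by
  have hcard := card_le_of_card_inter_typeClass_le (s₀ := s₀) (F := V.F N)
    (fun _ => V.length_of_mem_F) fun T => V.card_F_inter_le hM N
  -- Nonnegativity of `q` comes from any one conditional probability; an empty alphabet would
  -- contradict their summing to 1.
  have hq0 : 0 ≤ q ^ N := by
    rcases N.eq_zero_or_pos with rfl | hN
    · simp
    · rcases isEmpty_or_nonempty A with hA | ⟨⟨a⟩⟩
      · have := P.sum_one s₀
        simp at this
      · exact pow_nonneg ((P.pos s₀ a).le.trans (hq s₀ a)) N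
  have hsum : P.probSet s₀ (V.F N) ≤ (V.F N).card • q ^ N :=
    Finset.sum_le_card_nsmul _ _ _ fun x hx => by
      simpa only [V.length_of_mem_F hx] using P.prob_le_pow hq s₀ x
  rw [nsmul_eq_mul] at hsum
  refine hsum.trans ?_
  rw [← mul_assoc]
  exact mul_le_mul_of_nonneg_right (by exact_mod_cast hcard) hq0

/-- One pass splits the extensions of the failure set into the newly selected strings and the new
failure set. -/
theorem sum_D_succ_add_sum_F_succ (f : List A → ℝ) (n : ℕ) :
    ∑ x ∈ V.D (n + 1), f x + ∑ x ∈ V.F (n + 1), f x =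
      ∑ x ∈ V.D n, f x + ∑ x ∈ extendWords (V.F n), f x := by
  obtain ⟨S, hS, -, hD, hF⟩ := V.step n
  have hdisj : Disjoint (V.D n) S := Finset.disjoint_left.2 fun x hx hxS => by
    have h₁ := V.length_le_of_mem_D hx
    have h₂ := V.length_of_mem_extendWords_F (hS hxS)
    omega
  rw [hD, hF, Finset.sum_union hdisj, add_assoc, add_comm (∑ x ∈ S, f x), Finset.sum_sdiff hS]

theorem probSet_D_add_probSet_F (P : MarkovProcess A k) (n : ℕ) :
    P.probSet s₀ (V.D n) + P.probSet s₀ (V.F n) = 1 := by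
  induction n with
  | zero => simp [V.init_D, V.init_F, MarkovProcess.probSet, MarkovProcess.prob]
  | succ n ih =>
    rw [← ih, ← P.probSet_extendWords s₀ (V.F n)]
    exact V.sum_D_succ_add_sum_F_succ _ n

/-- Pass `n + 1` lengthens exactly the surviving strings by one symbol, so the expected length grows
by `P(F_n)`. -/
theorem lengthSum_D_add_lengthSum_F (P : MarkovProcess A k) (n : ℕ) :
    P.lengthSum s₀ (V.D n) + P.lengthSum s₀ (V.F n) =
      ∑ i ∈ Finset.range n, P.probSet s₀ (V.F i) := by
  induction n with
  | zero => simp [V.init_D, V.init_F, MarkovProcess.lengthSum]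
  | succ n ih =>
    have h : P.lengthSum s₀ (V.D (n + 1)) + P.lengthSum s₀ (V.F (n + 1)) =
        P.lengthSum s₀ (V.D n) + P.lengthSum s₀ (extendWords (V.F n)) :=
      V.sum_D_succ_add_sum_F_succ _ n
    rw [h, Finset.sum_range_succ, ← ih,
      P.lengthSum_eq_mul_probSet s₀ fun _ => V.length_of_mem_extendWords_F,
      P.lengthSum_eq_mul_probSet s₀ fun _ => V.length_of_mem_F, P.probSet_extendWords]
    push_cast
    ring

/-- The sets `D_N` exhaust the dictionary, so they are cofinal among its finite subsets, and `P(D_N)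
= 1 - P(F_N)` tends to 1. -/
theorem hasSum_prob_dict (P : MarkovProcess A k)
    (h : Tendsto (fun N => P.probSet s₀ (V.F N)) atTop (𝓝 0)) :
    HasSum (fun x : V.dict => P.prob s₀ x.1) 1 := by
  classical
  let U : ℕ → Finset V.dict := fun N => (V.D N).subtype (· ∈ V.dict)
  have hU : ∀ N, ∑ x ∈ U N, P.prob s₀ x.1 = P.probSet s₀ (V.D N) := fun N =>
    Finset.sum_subtype_of_mem _ fun x hx => V.mem_dict_of_mem_D hx
  have hUtop : Tendsto U atTop atTop := by
    refine tendsto_atTop_finset_of_monotone (fun m n hmn => ?_) fun x => ?_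
    · exact Finset.subtype_mono (V.D_mono hmn)
    · obtain ⟨N, -, hN⟩ := x.2
      exact ⟨N, Finset.mem_subtype.2 hN⟩
  have hsummable : Summable fun x : V.dict => P.prob s₀ x.1 := by
    refine summable_of_sum_le (c := 1) (fun x => P.prob_nonneg s₀ x.1) fun u => ?_
    obtain ⟨N, hN⟩ := (hUtop.eventually_ge_atTop u).exists
    calc ∑ x ∈ u, P.prob s₀ x.1 ≤ ∑ x ∈ U N, P.prob s₀ x.1 :=
          Finset.sum_le_sum_of_subset_of_nonneg hN fun x _ _ => P.prob_nonneg s₀ x.1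
      _ ≤ 1 := by
          rw [hU, ← V.probSet_D_add_probSet_F P N]
          exact le_add_of_nonneg_right (P.probSet_nonneg s₀ _)
  have hlim : Tendsto (fun N => P.probSet s₀ (V.D N)) atTop (𝓝 1) := by
    have h1 := h.const_sub 1
    rw [sub_zero] at h1
    exact h1.congr fun N => by rw [← V.probSet_D_add_probSet_F P N, add_sub_cancel_right]
  have hsum : Tendsto (fun N => ∑ x ∈ U N, P.prob s₀ x.1) atTop
      (𝓝 (∑' x : V.dict, P.prob s₀ x.1)) := hsummable.hasSum.comp hUtop
  simp only [hU] at hsum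
  exact tendsto_nhds_unique hsum hlim ▸ hsummable.hasSum

end GreedyVFR

/-! ### Assembly of the two claims. -/

theorem mainTheorem9 {A : Type*} [Fintype A] [DecidableEq A] [Nontrivial A] {k : ℕ}
    (s₀ : Fin k → A) (M : ℕ) (hM : 2 ≤ M) (P : MarkovProcess A k) :
    (∃ C ρ : ℝ, 0 < C ∧ 0 < ρ ∧ ρ < 1 ∧
      ∀ (V : GreedyVFR s₀ M) (N : ℕ), P.probSet s₀ (failureSet V.dict N) ≤ C * ρ ^ N) ∧
    (∀ V : GreedyVFR s₀ M,
      HasSum (fun x : V.dict => P.prob s₀ x.1) 1 ∧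
      ∃ L : ℝ, IsExpectedDictionaryLength P s₀ V.dict L ∧
        Tendsto (fun N => expectedInputLength P s₀ V.dict N) atTop (𝓝 L)) := by
  -- All constants are fixed before `V`, hence do not depend on the greedy choices.
  obtain ⟨q, hq0, hq1, hq⟩ := P.exists_p_le_lt_one
  obtain ⟨C, ρ, hC, hρ0, hρ1, hCρ⟩ :=
    exists_polynomial_mul_pow_le_geometric (Fintype.card ((Fin k → A) × A)) hq0 hq1
  have hM0 : 0 < M := by omega
  have hMR : (0 : ℝ) < M := by exact_mod_cast hM0
  have hF : ∀ (V : GreedyVFR s₀ M) (N : ℕ), P.probSet s₀ (V.F N) ≤ M * C * ρ ^ N := by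
    intro V N
    rw [mul_assoc]
    exact (V.probSet_F_le hM0 P hq N).trans (mul_le_mul_of_nonneg_left (hCρ N) hMR.le)
  refine ⟨⟨M * C, ρ, mul_pos hMR hC, hρ0, hρ1, fun V N =>
    (P.probSet_mono s₀ (V.failureSet_dict_subset N)).trans (hF V N)⟩, fun V => ?_⟩
  have hsummable : Summable fun N => P.probSet s₀ (V.F N) :=
    Summable.of_nonneg_of_le (fun N => P.probSet_nonneg s₀ _) (hF V)
      ((summable_geometric_of_lt_one hρ0.le hρ1).mul_left _)
  have hmul : Tendsto (fun N : ℕ => (N : ℝ) * P.probSet s₀ (V.F N)) atTop (𝓝 0) := by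
    have h := (tendsto_self_mul_const_pow_of_lt_one hρ0.le hρ1).const_mul (M * C)
    rw [mul_zero] at h
    refine squeeze_zero (fun N => mul_nonneg N.cast_nonneg (P.probSet_nonneg s₀ _))
      (fun N => ?_) h
    rw [mul_left_comm]
    exact mul_le_mul_of_nonneg_left (hF V N) N.cast_nonneg
  have hlen : Tendsto (fun N => P.lengthSum s₀ (V.D N)) atTop
      (𝓝 (∑' N, P.probSet s₀ (V.F N))) := by
    -- Tail-sum formula solved for the dictionary term: partial sums of `P(F_i)` minus the vanishing
    -- `N P(F_N)`.
    have h := hsummable.hasSum.tendsto_sum_nat.sub hmul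
    rw [sub_zero] at h
    refine h.congr fun N => ?_
    rw [← V.lengthSum_D_add_lengthSum_F P N,
      P.lengthSum_eq_mul_probSet s₀ (S := V.F N) fun _ => V.length_of_mem_F, add_sub_cancel_right]
  have hfail : Tendsto (fun N : ℕ => P.lengthSum s₀ (failureSet V.dict N)) atTop (𝓝 0) := by
    have heq : ∀ N : ℕ, P.lengthSum s₀ (failureSet V.dict N) =
        N * P.probSet s₀ (failureSet V.dict N) := fun N =>
      P.lengthSum_eq_mul_probSet s₀ fun x hx => (V.mem_failureSet_dict.1 hx).1
    simp only [heq]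
    exact squeeze_zero (fun N => mul_nonneg N.cast_nonneg (P.probSet_nonneg s₀ _))
      (fun N => mul_le_mul_of_nonneg_left
        (P.probSet_mono s₀ (V.failureSet_dict_subset N)) N.cast_nonneg) hmul
  refine ⟨V.hasSum_prob_dict P hsummable.tendsto_atTop_zero, ∑' N, P.probSet s₀ (V.F N), ?_, ?_⟩
  · simpa only [IsExpectedDictionaryLength, V.truncDict_dict] using hlen
  · have h := hlen.add hfail
    rw [add_zero] at h
    refine h.congr fun N => ?_
    rw [expectedInputLength, V.truncDict_dict]
    exact (Finset.sum_union (V.disjoint_D_failureSet_dict N)).symm
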